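/- **Setting.** Nodes $0,1,\dots,m$ form a chain. At each time step $i=1,\dots,n$, every node $j\in\{0,\dots,m-1\}$ sends one bit to node $j+1$ over a binary symmetric channel with crossover probability $p$; all channel uses are independent, and what relay node $j$ sends at time $i$ depends only on what it received at times $1,\dots,i-1$. Node $0$ is given a message of $k\ge 1$ bits, and after $n$ steps node $m$ outputs an estimate of it; an error occurs if the estimate differs from the message. **Parameters.** For $l\ge 1$ let $t_l=(l+2)^2$ and $b_l=\lfloor (l+2)^2/4\rfloor$. Let $r_l=\lceil\log_2 b_l\rceil+1$ for $l\ge 2$ and $r_1=3$ (so $b_1=2$). Put $k_l=\prod_{i=1}^l b_i$, $n_l=\prod_{i=1}^l (b_i+r_i)$ and $T_l=\prod_{i=1}^l t_i$, with $k_0=n_0=T_0=1$. **Coding.** Level-$0$ encoding and decoding are the identity on one bit. For $l\ge 1$, the level-$l$ encoder splits $k_l$ bits into $b_l$ blocks of $k_{l-1}$ bits, appends $r_l$ redundancy blocks by applying, in each of the $k_{l-1}$ positions separately, the systematic (shortened) Hamming code with $b_l$ data bits and $r_l$ parity bits, and encodes each of the $b_l+r_l$ blocks at level $l-1$; this gives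 $n_l$ bits. The level-$l$ decoder splits $n_l$ bits into $b_l+r_l$ blocks of $n_{l-1}$ bits, decodes each at level $l-1$, and then applies in each position the syndrome decoder of the Hamming code, which corrects one error. **Protocol.** A relay node $j\in\{1,\dots,m-1\}$ has level $l(j)$, the largest $l$ with $T_l\mid j$. Let $L'$ be the largest level of a relay node ($0$ if there are none), let $L$ satisfy $k_L\le k<k_{L+1}$, and let $M=\max\{L,L'\}$. Node $0$ pads the message with zeros to $\lceil k/k_M\rceil$ blocks of $k_M$ bits, encodes each block at level $M$ and sends the result, starting at time $1$. Relay node $j$ ignores what it receives before the first bit that node $j-1$ meaningfully sends; from then on it reads successive blocks of $n_{l(j)}$ bits, decodes and re-encodes each at level $l(j)$, and sends the result, starting as soon as it has read its first block. Node $m$ decodes the blocks at level $M$. The total transmission time is thus $$n(m,k)=\sum_{j=1}^{m-1} n_{l(j)}+\lceil k/k_M\rceil\, n_M .$$ **Theorem.** There is a constant $C$ such that $n(m,k)\le C(m+k)$ for all $m,k\ge 1$. Moreover, if $p<3^{-8}/4$, then the error probability of this protocol tends to $0$ as $m\to\infty$, uniformly in $k\ge 1$ and in the message: for every $\varepsilon>0$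 there is an $m_0$ such that for all $m\ge m_0$, all $k\ge 1$ and every message of $k$ bits, the error probability is at most $\varepsilon$. -/

import Mathlib

open MeasureTheory ProbabilityTheory

namespace RelayChain

/-! ### The tandem of binary symmetric channels

Bits are elements of `ZMod 2`, so that XOR is addition. There are nodes `0, …, m`, and channel `j`
leads from node `j` to node `j + 1`. There are `n` time steps, numbered `0, …, n - 1`. -/

/-- A deterministic protocol that transmits `k` bits over `m` hops in `n` time steps.
What node `j` sends at time step `i` depends only on what it received at time steps `0, …, i - 1`
(the entry `j = 0` of `relay` is not used: node `0` is the encoder). -/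
structure Protocol (k m n : ℕ) where
  /-- the bit that node `0` sends at each time step, given the message -/
  encoder : (Fin k → ZMod 2) → Fin n → ZMod 2
  /-- the bit that relay node `j` sends at time step `i`, given what it received before -/
  relay : Fin m → (i : Fin n) → (Fin (i : ℕ) → ZMod 2) → ZMod 2
  /-- the estimate of the message that node `m` forms after `n` time steps -/
  decoder : (Fin n → ZMod 2) → Fin k → ZMod 2

/-- The bit that is added to the transmitted bit by a channel: `1` if the channel flips it. -/
def flipBit (z : Bool) : ZMod 2 := if z then 1 else 0

/-- The output of channel `j` at time step `i`, i.e. what node `j + 1` receives, when node `0` is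
given the message `msg` and `z (j, i)` tells whether channel `j` flips its bit at time step `i`. -/
def Protocol.received {k m n : ℕ} (P : Protocol k m n) (msg : Fin k → ZMod 2)
    (z : Fin m × Fin n → Bool) : (j : ℕ) → j < m → Fin n → ZMod 2
  | 0, h, i => P.encoder msg i + flipBit (z (⟨0, h⟩, i))
  | j + 1, h, i =>
      P.relay ⟨j + 1, h⟩ i
        (fun i' => P.received msg z j (Nat.lt_of_succ_lt h) ⟨i', i'.isLt.trans i.isLt⟩)
      + flipBit (z (⟨j + 1, h⟩, i))

/-- The estimate of the message that node `m` outputs. -/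
def Protocol.estimate {k m n : ℕ} (P : Protocol k m n) (hm : 0 < m) (msg : Fin k → ZMod 2)
    (z : Fin m × Fin n → Bool) : Fin k → ZMod 2 :=
  P.decoder (P.received msg z (m - 1) (Nat.sub_lt hm Nat.one_pos))

/-- The law of the channel noise: all flips are independent, each has probability `p`. -/
noncomputable def noise (m n : ℕ) (p : unitInterval) : Measure (Fin m × Fin n → Bool) :=
  Measure.pi fun _ => bernoulliMeasure true false p

/-- The probability that the estimate differs from the message `msg`. -/
noncomputable def Protocol.errorProb {k m n : ℕ} (P : Protocol k m n) (hm : 0 < m)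
    (p : unitInterval) (msg : Fin k → ZMod 2) : ℝ :=
  (noise m n p).real {z | P.estimate hm msg z ≠ msg}

/-! ### The single-error-correcting (shortened) Hamming code -/

/-- The number of redundancy positions that are added to `b ≥ 1` data positions:
`⌈log₂ b⌉ + 1` for `b ≥ 3`, one more for `b ≤ 2` (where fewer cannot correct an error). -/
def redundancy (b : ℕ) : ℕ := if b ≤ 2 then Nat.clog 2 b + 2 else Nat.clog 2 b + 1

/-- The label of position `c` of the code with `b` data positions, followed by redundancy
positions. The data positions are labelled `3, 5, 6, 7, 9, …` (the positive integers that are not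
powers of two, in increasing order), the redundancy positions `1, 2, 4, 8, …`. -/
noncomputable def label (b c : ℕ) : ℕ :=
  if c < b then Nat.nth (fun x => 0 < x ∧ ∀ i : ℕ, x ≠ 2 ^ i) c else 2 ^ (c - b)

/-- The parity-check matrix: its column `c` is the binary expansion of the label of `c`. -/
noncomputable def parityCheck (b j c : ℕ) : ZMod 2 := if (label b c).testBit j then 1 else 0

/-- Position `c` of the codeword of the data word `v`. -/
noncomputable def hammingEncode (b : ℕ) (v : ℕ → ZMod 2) (c : ℕ) : ZMod 2 :=
  if c < b then v c else ∑ d ∈ Finset.range b, parityCheck b (c - b) d * v d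

/-- Parity check `j` of a received word `w`. -/
noncomputable def syndrome (b : ℕ) (w : ℕ → ZMod 2) (j : ℕ) : ZMod 2 :=
  ∑ c ∈ Finset.range (b + redundancy b), parityCheck b j c * w c

open scoped Classical in
/-- The data bit `d` that is decoded from the received word `w`: it is flipped if the syndrome is
column `d` of the parity-check matrix. -/
noncomputable def hammingDecode (b : ℕ) (w : ℕ → ZMod 2) (d : ℕ) : ZMod 2 :=
  w d + if ∀ j < redundancy b, syndrome b w j = parityCheck b j d then 1 else 0

/-! ### The recursive encoder and decoder

The sequence `b 1, b 2, …` gives the numbers of data blocks; `b 0` is not used. -/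

/-- The number of message bits of a level-`l` block. -/
def msgLen (b : ℕ → ℕ) (l : ℕ) : ℕ := ∏ i ∈ Finset.Icc 1 l, b i

/-- The number of transmitted bits of a level-`l` block. -/
def codeLen (b : ℕ → ℕ) (l : ℕ) : ℕ := ∏ i ∈ Finset.Icc 1 l, (b i + redundancy (b i))

/-- Level-`l` encoding. Only the first `msgLen b l` bits of the argument and the first
`codeLen b l` bits of the value are meaningful. The message bits are split into `b l` blocks, to
which redundancy blocks are added by applying the Hamming code in each position of the blocks
separately; then each of the blocks is encoded at level `l - 1`. -/
noncomputable def encode (b : ℕ → ℕ) : ℕ → (ℕ → ZMod 2) → ℕ → ZMod 2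
  | 0, u => u
  | l + 1, u => fun i =>
      encode b l
        (fun x => hammingEncode (b (l + 1)) (fun d => u (d * msgLen b l + x)) (i / codeLen b l))
        (i % codeLen b l)

/-- Level-`l` decoding. Only the first `codeLen b l` bits of the argument and the first
`msgLen b l` bits of the value are meaningful. Each of the blocks (including the redundancy blocks)
is decoded at level `l - 1`; then the Hamming code is decoded in each position separately. -/
noncomputable def decode (b : ℕ → ℕ) : ℕ → (ℕ → ZMod 2) → ℕ → ZMod 2
  | 0, y => y
  | l + 1, y => fun i =>
      hammingDecode (b (l + 1))
        (fun c => decode b l (fun s => y (c * codeLen b l + s)) (i % msgLen b l))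
        (i / msgLen b l)

/-! ### The full protocol

The sequence `t 1, t 2, …` gives the arrangement of the nodes in levels; `t 0` is not used. -/

/-- The level of a relay node `j ≥ 1`: the largest `l` such that `t 1 * ⋯ * t l` divides `j`
(when all `t i ≥ 2`, every such `l` is less than `j`). -/
def level (t : ℕ → ℕ) (j : ℕ) : ℕ := Nat.findGreatest (fun l => ∏ i ∈ Finset.Icc 1 l, t i ∣ j) j

/-- The maximum level of the relay nodes `1, …, m - 1` (and `0` if there are none). -/
def maxRelayLevel (t : ℕ → ℕ) (m : ℕ) : ℕ := (Finset.Icc 1 (m - 1)).sup (level t)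

/-- The level `l` with `msgLen b l ≤ k < msgLen b (l + 1)`
(when all `b i ≥ 2`, this level is less than `k`). -/
def msgLevel (b : ℕ → ℕ) (k : ℕ) : ℕ := Nat.findGreatest (fun l => msgLen b l ≤ k) k

/-- The level at which nodes `0` and `m` operate. -/
def topLevel (b t : ℕ → ℕ) (m k : ℕ) : ℕ := max (msgLevel b k) (maxRelayLevel t m)

/-- The number of top-level blocks into which the message, padded with zeros to a multiple of the
top-level message length, is split. This is `1` if the message is shorter than that length. -/
def numBlocks (b t : ℕ → ℕ) (m k : ℕ) : ℕ := k ⌈/⌉ msgLen b (topLevel b t m k)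

/-- Relay node `j` starts to transmit at time step `delay b t j` (so does node `0`, at time step
`0`): every relay node waits for one block of its own level. Hence the first meaningful bit of
node `j` reaches node `j + 1` at time step `delay b t j`. -/
def delay (b t : ℕ → ℕ) (j : ℕ) : ℕ := ∑ j' ∈ Finset.Icc 1 j, codeLen b (level t j')

/-- The total transmission time: the propagation delay up to node `m - 1`, plus the number of bits
that node `0` has to send. -/
def transmissionTime (b t : ℕ → ℕ) (m k : ℕ) : ℕ :=
  delay b t (m - 1) + numBlocks b t m k * codeLen b (topLevel b t m k)

/-- The protocol that transmits `k` bits over `m` hops. -/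
noncomputable def multiBitProtocol (b t : ℕ → ℕ) (m k : ℕ) :
    Protocol k m (transmissionTime b t m k) where
  -- The message is padded with zeros and encoded block by block.
  encoder msg i :=
    let l := topLevel b t m k
    encode b l
      (fun x =>
        let d := (i : ℕ) / codeLen b l * msgLen b l + x
        if h : d < k then msg ⟨d, h⟩ else 0)
      ((i : ℕ) % codeLen b l)
  -- From time step `delay b t j` on, a relay node transmits, block by block, the re-encoding of the
  -- decoded block; the block itself arrives from time step `delay b t (j - 1)` on.
  relay j i y :=
    if (i : ℕ) < delay b t j then 0
    else
      let l := level t j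
      let q := (i : ℕ) - delay b t j
      encode b l
        (decode b l fun s =>
          let r := delay b t ((j : ℕ) - 1) + q / codeLen b l * codeLen b l + s
          if h : r < (i : ℕ) then y ⟨r, h⟩ else 0)
        (q % codeLen b l)
  -- The received bits, from time step `delay b t (m - 1)` on, are decoded block by block.
  decoder y d :=
    let l := topLevel b t m k
    decode b l
      (fun s =>
        let r := delay b t (m - 1) + (d : ℕ) / msgLen b l * codeLen b l + s
        if h : r < transmissionTime b t m k then y ⟨r, h⟩ else 0)
      ((d : ℕ) % msgLen b l)

/-- The arrangement of levels `t l = (l + 2)²`. -/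
def tSeq (l : ℕ) : ℕ := (l + 2) ^ 2

/-- The numbers of data blocks `b l = ⌊(l + 2)² / 4⌋`. -/
def bSeq (l : ℕ) : ℕ := (l + 2) ^ 2 / 4

end RelayChain

/-!
The Hamming code corrects one wrong position. Cut a level-`l + 1` block that travels `T_{l + 1}`
hops into its sub-blocks of level `l`, each travelling `T_l` hops: it arrives intact unless two of
these `N = t_{l + 1} (b_{l + 1} + r_{l + 1})` sub-blocks are corrupted. Distinct blocks have
disjoint families of sub-blocks, so if the corruptions at level `l` are dominated, set by set, by
independent ones of probability `q`, then by the union bound over pairs those at level `l + 1` are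
dominated with `N² q²`. Below the threshold on `p` these bounds decay faster than the number of
top-level blocks grows.

The relay nodes of level `l` have density at most `1 / T_l` and cause a delay of `n_l`, where
`n_l / T_l` is at most `(5 / 9) ^ l`, so the total delay is linear in the number of hops. The
message is sent at a rate bounded below because `∑ r_l / b_l` converges.
-/

namespace RelayChain

/-- A label of a data position of the Hamming code: a positive integer that is not a power of
two. -/
abbrev IsDataLabel (x : ℕ) : Prop := 0 < x ∧ ∀ i : ℕ, x ≠ 2 ^ i

theorem infinite_setOf_isDataLabel : {x | IsDataLabel x}.Infinite := by
  refine Set.infinite_of_forall_exists_gt fun n => ⟨2 * n + 3, ⟨by omega, fun i => ?_⟩, by omega⟩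
  cases i with
  | zero => simp
  | succ i => rw [pow_succ]; omega

open scoped Classical in
theorem two_pow_le_count_isDataLabel_add (r : ℕ) :
    2 ^ r ≤ Nat.count IsDataLabel (2 ^ r) + (r + 1) := by
  have not_label_subset : {x ∈ Finset.range (2 ^ r) | ¬ IsDataLabel x} ⊆
      insert 0 ((Finset.range r).image (2 ^ ·)) := by
    intro x hx
    obtain ⟨hxr, hx⟩ := Finset.mem_filter.1 hx
    rcases Nat.eq_zero_or_pos x with rfl | hpos
    · exact Finset.mem_insert_self _ _
    · obtain ⟨i, rfl⟩ : ∃ i, x = 2 ^ i := by simpa [IsDataLabel, hpos] using hx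
      have hir : i < r := (Nat.pow_lt_pow_iff_right one_lt_two).1 (Finset.mem_range.1 hxr)
      exact Finset.mem_insert_of_mem (Finset.mem_image_of_mem _ (Finset.mem_range.2 hir))
  have card_not_label : {x ∈ Finset.range (2 ^ r) | ¬ IsDataLabel x}.card ≤ r + 1 :=
    calc _ ≤ ((Finset.range r).image (2 ^ ·)).card + 1 :=
          (Finset.card_le_card not_label_subset).trans (Finset.card_insert_le _ _)
      _ ≤ r + 1 := Nat.add_le_add_right (Finset.card_image_le.trans (Finset.card_range r).le) 1
  calc 2 ^ r
      = Nat.count IsDataLabel (2 ^ r) + {x ∈ Finset.range (2 ^ r) | ¬ IsDataLabel x}.card := by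
        rw [Nat.count_eq_card_filter_range, Finset.card_filter_add_card_filter_not,
          Finset.card_range]
    _ ≤ _ := Nat.add_le_add_left card_not_label _

theorem redundancy_pos (b : ℕ) : 0 < redundancy b := by
  unfold redundancy; split_ifs <;> omega

theorem redundancy_le_clog_add_two (b : ℕ) : redundancy b ≤ Nat.clog 2 b + 2 := by
  unfold redundancy; split_ifs <;> omega

theorem redundancy_le_self {b : ℕ} (hb : 3 ≤ b) : redundancy b ≤ b := by
  have clog_le : Nat.clog 2 b ≤ b - 1 := Nat.clog_le_of_le_pow <| by
    have := Nat.lt_two_pow_self (n := b - 1)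
    omega
  rw [redundancy, if_neg (by omega)]
  omega

theorem add_redundancy_lt_two_pow (b : ℕ) : b + redundancy b < 2 ^ redundancy b := by
  have clog_two : Nat.clog 2 2 = 1 := Nat.clog_eq_one le_rfl le_rfl
  unfold redundancy
  split_ifs with hb
  · interval_cases b <;> simp [clog_two]
  · have le_pow : b ≤ 2 ^ Nat.clog 2 b := Nat.le_pow_clog one_lt_two b
    have two_le : 2 ≤ Nat.clog 2 b := (Nat.lt_clog_iff_pow_lt one_lt_two).2 (by omega)
    have add_two_le : ∀ n, 2 ≤ n → n + 2 ≤ 2 ^ n := Nat.le_induction (by norm_num)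
      fun n _ ih => by rw [pow_succ]; omega
    have := add_two_le _ two_le
    rw [pow_succ]
    omega

theorem label_pos (b c : ℕ) : 0 < label b c := by
  unfold label
  split_ifs
  · exact (Nat.nth_mem_of_infinite infinite_setOf_isDataLabel c).1
  · positivity

theorem label_lt_two_pow {b c : ℕ} (hc : c < b + redundancy b) :
    label b c < 2 ^ redundancy b := by
  unfold label
  split_ifs with h
  · classical
    refine Nat.nth_lt_of_lt_count (p := IsDataLabel) ?_
    have := two_pow_le_count_isDataLabel_add (redundancy b)
    have := add_redundancy_lt_two_pow b
    omega
  · exact Nat.pow_lt_pow_right one_lt_two (by omega)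

theorem label_injective (b : ℕ) : Function.Injective (label b) := by
  have nth_ne_two_pow (c i : ℕ) : Nat.nth IsDataLabel c ≠ 2 ^ i :=
    (Nat.nth_mem_of_infinite infinite_setOf_isDataLabel c).2 i
  intro c d h
  unfold label at h
  split_ifs at h with hc hd hd
  · exact Nat.nth_injective infinite_setOf_isDataLabel h
  · exact absurd h (nth_ne_two_pow c _)
  · exact absurd h.symm (nth_ne_two_pow d _)
  · have := Nat.pow_right_injective le_rfl h
    omega

theorem parityCheck_eq_parityCheck_iff {b i j c d : ℕ} :
    parityCheck b i c = parityCheck b j d ↔ (label b c).testBit i = (label b d).testBit j := by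
  unfold parityCheck
  cases (label b c).testBit i <;> cases (label b d).testBit j <;> simp

theorem testBit_label_eq_false {b c j : ℕ} (hc : c < b + redundancy b) (hj : redundancy b ≤ j) :
    (label b c).testBit j = false :=
  Nat.testBit_lt_two_pow ((label_lt_two_pow hc).trans_le (Nat.pow_le_pow_right two_pos hj))

theorem eq_of_parityCheck_eq {b c d : ℕ} (hc : c < b + redundancy b)
    (hd : d < b + redundancy b) (h : ∀ j < redundancy b, parityCheck b j c = parityCheck b j d) :
    c = d := by
  refine label_injective b (Nat.eq_of_testBit_eq fun j => ?_)
  rcases lt_or_ge j (redundancy b) with hj | hj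
  · exact parityCheck_eq_parityCheck_iff.1 (h j hj)
  · rw [testBit_label_eq_false hc hj, testBit_label_eq_false hd hj]

theorem exists_parityCheck_ne_zero {b c : ℕ} (hc : c < b + redundancy b) :
    ∃ j < redundancy b, parityCheck b j c ≠ 0 := by
  obtain ⟨j, hj⟩ := Nat.exists_testBit_of_ne_zero (label_pos b c).ne'
  refine ⟨j, ?_, by simp [parityCheck, hj]⟩
  by_contra! hle
  exact absurd (testBit_label_eq_false hc hle) (by simp [hj])

theorem parityCheck_add (b j i : ℕ) : parityCheck b j (b + i) = if i = j then 1 else 0 := by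
  simp [parityCheck, label, Nat.testBit_two_pow]

theorem hammingEncode_of_lt {b d : ℕ} (hd : d < b) (v : ℕ → ZMod 2) :
    hammingEncode b v d = v d :=
  if_pos hd

theorem hammingEncode_congr {b : ℕ} {v v' : ℕ → ZMod 2} (h : ∀ d < b, v d = v' d) :
    hammingEncode b v = hammingEncode b v' := by
  funext c
  unfold hammingEncode
  split_ifs with hc
  · exact h c hc
  · exact Finset.sum_congr rfl fun d hd => by rw [h d (Finset.mem_range.1 hd)]

theorem syndrome_hammingEncode {b j : ℕ} (hj : j < redundancy b) (v : ℕ → ZMod 2) :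
    syndrome b (hammingEncode b v) j = 0 := by
  have data_sum : ∑ c ∈ Finset.range b, parityCheck b j c * hammingEncode b v c =
      ∑ d ∈ Finset.range b, parityCheck b j d * v d :=
    Finset.sum_congr rfl fun c hc => by rw [hammingEncode_of_lt (Finset.mem_range.1 hc)]
  have redundancy_sum :
      ∑ i ∈ Finset.range (redundancy b), parityCheck b j (b + i) * hammingEncode b v (b + i) =
        ∑ d ∈ Finset.range b, parityCheck b j d * v d := by
    simp [parityCheck_add, hammingEncode, hj]
  rw [syndrome, Finset.sum_range_add, data_sum, redundancy_sum]
  exact CharTwo.add_self_eq_zero _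

theorem syndrome_eq_sum_errors {b j : ℕ} (hj : j < redundancy b) (v w : ℕ → ZMod 2) :
    syndrome b w j =
      ∑ c ∈ Finset.range (b + redundancy b) with w c ≠ hammingEncode b v c, parityCheck b j c := by
  have eq_add_error (x y : ZMod 2) : x = y + if x ≠ y then 1 else 0 := by
    revert x y; decide
  calc syndrome b w j
      = ∑ c ∈ Finset.range (b + redundancy b), (parityCheck b j c * hammingEncode b v c +
          if w c ≠ hammingEncode b v c then parityCheck b j c else 0) := by
        refine Finset.sum_congr rfl fun c _ => ?_
        conv_lhs =>
          rw [eq_add_error (w c) (hammingEncode b v c), mul_add, mul_ite, mul_one, mul_zero]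
    _ = syndrome b (hammingEncode b v) j + _ := by
        rw [Finset.sum_add_distrib, ← Finset.sum_filter]; rfl
    _ = _ := by rw [syndrome_hammingEncode hj, zero_add]

theorem hammingDecode_eq_of_subsingleton_errors {b : ℕ} {v w : ℕ → ZMod 2}
    (h : {c | c < b + redundancy b ∧ w c ≠ hammingEncode b v c}.Subsingleton) {d : ℕ}
    (hd : d < b) : hammingDecode b w d = v d := by
  have hd' : d < b + redundancy b := by omega
  have syndrome_eq {c : ℕ} (hc : c < b + redundancy b) (hwc : w c ≠ hammingEncode b v c)
      {j : ℕ} (hj : j < redundancy b) : syndrome b w j = parityCheck b j c := by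
    rw [syndrome_eq_sum_errors hj v, ← Finset.sum_singleton (parityCheck b j) c]
    refine Finset.sum_congr (Finset.eq_singleton_iff_unique_mem.2 ?_) fun _ _ => rfl
    simp only [Finset.mem_filter, Finset.mem_range]
    exact ⟨⟨hc, hwc⟩, fun c' hc' => h hc' ⟨hc, hwc⟩⟩
  rw [hammingDecode, ← hammingEncode_of_lt hd v]
  by_cases hwd : w d = hammingEncode b v d
  · rw [if_neg, add_zero, hwd]
    intro syndrome_eq_d
    by_cases herr : ∃ c < b + redundancy b, w c ≠ hammingEncode b v c
    · obtain ⟨c, hc, hwc⟩ := herr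
      have hcd : c = d := eq_of_parityCheck_eq hc hd' fun j hj =>
        (syndrome_eq hc hwc hj).symm.trans (syndrome_eq_d j hj)
      exact hwc (hcd ▸ hwd)
    · push Not at herr
      obtain ⟨j, hj, hne⟩ := exists_parityCheck_ne_zero hd'
      rw [← syndrome_eq_d j hj, syndrome_eq_sum_errors hj v] at hne
      refine hne (Finset.sum_eq_zero fun c hc => ?_)
      obtain ⟨hc, hwc⟩ := Finset.mem_filter.1 hc
      exact absurd (herr c (Finset.mem_range.1 hc)) hwc
  · rw [if_pos fun j hj => syndrome_eq hd' hwd hj]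
    generalize w d = x at hwd ⊢
    generalize hammingEncode b v d = y at hwd ⊢
    revert x y; decide

theorem hammingDecode_congr {b : ℕ} {w w' : ℕ → ZMod 2}
    (h : ∀ c < b + redundancy b, w c = w' c) {d : ℕ} (hd : d < b) :
    hammingDecode b w d = hammingDecode b w' d := by
  have syndrome_congr : syndrome b w = syndrome b w' := funext fun j =>
    Finset.sum_congr rfl fun c hc => by rw [h c (Finset.mem_range.1 hc)]
  rw [hammingDecode, hammingDecode, syndrome_congr, h d (by omega)]


/-- The number of hops of a level-`l` segment of the chain: segment `a` of level `l` consists of the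
nodes `a * hopLen t l, …, (a + 1) * hopLen t l - 1`. -/
def hopLen (t : ℕ → ℕ) (l : ℕ) : ℕ := ∏ i ∈ Finset.Icc 1 l, t i

/-- Block number `q` of a stream `y` that is split into blocks of `n` symbols. -/
def block {α : Type*} (n q : ℕ) (y : ℕ → α) (s : ℕ) : α := y (q * n + s)

/-- The message that is encoded at level `l` in block `c` of the level-`(l + 1)` encoding
of `u`. -/
noncomputable def subMessage (b : ℕ → ℕ) (l : ℕ) (u : ℕ → ZMod 2) (c x : ℕ) : ZMod 2 :=
  hammingEncode (b (l + 1)) (fun d => block (msgLen b l) d u x) c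

theorem mul_add_div_of_lt {n s : ℕ} (q : ℕ) (hs : s < n) : (q * n + s) / n = q := by
  rw [mul_comm, Nat.mul_add_div (by omega), Nat.div_eq_of_lt hs, add_zero]

theorem mul_add_lt_mul {q m s n : ℕ} (hq : q < m) (hs : s < n) : q * n + s < m * n :=
  mul_comm n q ▸ Nat.mul_add_lt_mul_of_lt_of_lt hq hs

theorem hopLen_zero (t : ℕ → ℕ) : hopLen t 0 = 1 := by simp [hopLen]

theorem hopLen_succ (t : ℕ → ℕ) (l : ℕ) : hopLen t (l + 1) = t (l + 1) * hopLen t l := by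
  rw [hopLen, Finset.prod_Icc_succ_top (by omega), mul_comm, hopLen]

theorem msgLen_zero (b : ℕ → ℕ) : msgLen b 0 = 1 := by simp [msgLen]

theorem msgLen_succ (b : ℕ → ℕ) (l : ℕ) : msgLen b (l + 1) = b (l + 1) * msgLen b l := by
  rw [msgLen, Finset.prod_Icc_succ_top (by omega), mul_comm, msgLen]

theorem codeLen_zero (b : ℕ → ℕ) : codeLen b 0 = 1 := by simp [codeLen]

theorem codeLen_succ (b : ℕ → ℕ) (l : ℕ) :
    codeLen b (l + 1) = (b (l + 1) + redundancy (b (l + 1))) * codeLen b l := by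
  rw [codeLen, Finset.prod_Icc_succ_top (by omega), mul_comm, codeLen]

theorem codeLen_pos (b : ℕ → ℕ) (l : ℕ) : 0 < codeLen b l :=
  Finset.prod_pos fun i _ => Nat.add_pos_right _ (redundancy_pos (b i))

theorem hopLen_dvd_hopLen (t : ℕ → ℕ) {l l' : ℕ} (h : l ≤ l') : hopLen t l ∣ hopLen t l' :=
  Finset.prod_dvd_prod_of_subset _ _ _ (Finset.Icc_subset_Icc_right h)

theorem strictMono_prod_Icc_one {f : ℕ → ℕ} (hf : ∀ i, 1 ≤ i → 2 ≤ f i) :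
    StrictMono fun l => ∏ i ∈ Finset.Icc 1 l, f i := by
  refine strictMono_nat_of_lt_succ fun l => ?_
  have prod_pos : 0 < ∏ i ∈ Finset.Icc 1 l, f i :=
    Finset.prod_pos fun i hi => two_pos.trans_le (hf i (Finset.mem_Icc.1 hi).1)
  rw [Finset.prod_Icc_succ_top (by omega)]
  exact lt_mul_of_one_lt_right prod_pos (hf (l + 1) (by omega))

theorem strictMono_hopLen {t : ℕ → ℕ} (ht : ∀ i, 1 ≤ i → 2 ≤ t i) : StrictMono (hopLen t) :=
  strictMono_prod_Icc_one ht

theorem strictMono_msgLen {b : ℕ → ℕ} (hb : ∀ i, 1 ≤ i → 2 ≤ b i) : StrictMono (msgLen b) :=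
  strictMono_prod_Icc_one hb

theorem hopLen_pos {t : ℕ → ℕ} (ht : ∀ i, 1 ≤ i → 2 ≤ t i) (l : ℕ) : 0 < hopLen t l :=
  one_pos.trans_le ((hopLen_zero t).ge.trans ((strictMono_hopLen ht).monotone l.zero_le))

theorem msgLen_pos {b : ℕ → ℕ} (hb : ∀ i, 1 ≤ i → 2 ≤ b i) (l : ℕ) : 0 < msgLen b l :=
  hopLen_pos hb l

theorem hopLen_level_dvd (t : ℕ → ℕ) (j : ℕ) : hopLen t (level t j) ∣ j :=
  Nat.findGreatest_spec (P := fun l => hopLen t l ∣ j) (Nat.zero_le j) (by simp [hopLen_zero])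

theorem le_level {t : ℕ → ℕ} (ht : ∀ i, 1 ≤ i → 2 ≤ t i) {l j : ℕ} (hj : 0 < j)
    (h : hopLen t l ∣ j) : l ≤ level t j :=
  Nat.le_findGreatest ((strictMono_hopLen ht).le_apply.trans (Nat.le_of_dvd hj h)) h

theorem level_mul_hopLen {t : ℕ → ℕ} (ht : ∀ i, 1 ≤ i → 2 ≤ t i) {l a i : ℕ} (hi : 0 < i)
    (hit : i < t (l + 1)) : level t ((a * t (l + 1) + i) * hopLen t l) = l := by
  refine le_antisymm (not_lt.1 fun hlt => ?_)
    (le_level ht (Nat.mul_pos (by omega) (hopLen_pos ht l)) (Dvd.intro_left _ rfl))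
  have hdvd := (hopLen_dvd_hopLen t hlt).trans (hopLen_level_dvd t _)
  rw [hopLen_succ] at hdvd
  have t_dvd : t (l + 1) ∣ i := (Nat.dvd_add_right (Dvd.intro_left a rfl)).1
    (Nat.dvd_of_mul_dvd_mul_right (hopLen_pos ht l) hdvd)
  exact absurd (Nat.le_of_dvd hi t_dvd) (by omega)

theorem encode_congr {b : ℕ → ℕ} {l : ℕ} {u u' : ℕ → ZMod 2} (h : ∀ x < msgLen b l, u x = u' x)
    {i : ℕ} (hi : i < codeLen b l) : encode b l u i = encode b l u' i := by
  induction l generalizing u u' i with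
  | zero =>
    rw [codeLen_zero] at hi
    exact h i (by rwa [msgLen_zero])
  | succ l ih =>
    refine ih (fun x hx => ?_) (Nat.mod_lt _ (codeLen_pos b l))
    refine congrFun (hammingEncode_congr fun d hd => h _ ?_) _
    rw [msgLen_succ]
    exact mul_add_lt_mul hd hx

theorem decode_congr {b : ℕ → ℕ} {l : ℕ} {y y' : ℕ → ZMod 2}
    (h : ∀ s < codeLen b l, y s = y' s) {i : ℕ} (hi : i < msgLen b l) :
    decode b l y i = decode b l y' i := by
  induction l generalizing y y' i with
  | zero =>
    rw [msgLen_zero] at hi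
    exact h i (by rwa [codeLen_zero])
  | succ l ih =>
    rw [msgLen_succ] at hi
    have hpos : 0 < msgLen b l := Nat.pos_of_mul_pos_left (Nat.zero_lt_of_lt hi)
    simp only [decode]
    refine hammingDecode_congr (fun c hc => ih (fun s hs => h _ ?_) (Nat.mod_lt _ hpos))
      ((Nat.div_lt_iff_lt_mul hpos).2 hi)
    rw [codeLen_succ]
    exact mul_add_lt_mul hc hs

theorem block_block {α : Type*} (n B q c : ℕ) (y : ℕ → α) :
    block n c (block (B * n) q y) = block n (q * B + c) y := by
  funext s
  unfold block
  congr 1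
  ring

theorem block_encode_succ {b : ℕ → ℕ} {l : ℕ} (u : ℕ → ZMod 2) (c : ℕ) {s : ℕ}
    (hs : s < codeLen b l) :
    block (codeLen b l) c (encode b (l + 1) u) s = encode b l (subMessage b l u c) s := by
  simp only [block, encode, mul_add_div_of_lt c hs, Nat.mul_add_mod_of_lt hs]
  rfl

/-! ### Propagation of a block along the chain -/

/-- Block `q` of the stream `x` is the level-`l` encoding of the message `u`. -/
def SendsBlock (b : ℕ → ℕ) (l q : ℕ) (u x : ℕ → ZMod 2) : Prop :=
  ∀ s < codeLen b l, block (codeLen b l) q x s = encode b l u s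

/-- Level-`l` decoding of block `q` of the stream `y` yields the message `u`. -/
def DecodesBlock (b : ℕ → ℕ) (l q : ℕ) (u y : ℕ → ZMod 2) : Prop :=
  ∀ i < msgLen b l, decode b l (block (codeLen b l) q y) i = u i

/-- Every relay node `j + 1 < m` sends the re-encodings of the decoded blocks of its level, as far
as these lie within the first `S` bits of its stream. Here `X j` is the stream that node `j` sends,
and `Y j` the one that node `j + 1` receives, each counted from its first meaningful bit. -/
def IsRelayed (b t : ℕ → ℕ) (X Y : ℕ → ℕ → ZMod 2) (m S : ℕ) : Prop :=
  ∀ j, j + 1 < m → ∀ q, (q + 1) * codeLen b (level t (j + 1)) ≤ S →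
    SendsBlock b (level t (j + 1)) q
      (decode b (level t (j + 1)) (block (codeLen b (level t (j + 1))) q (Y j))) (X (j + 1))

/-- Whatever level-`l` block node `lo` sends as block number `q`, it is decoded correctly from the
streams that channels `lo, …, hi - 1` (of `m` channels) deliver. -/
def Transmits (b : ℕ → ℕ) (X Y : ℕ → ℕ → ZMod 2) (m l q lo hi : ℕ) : Prop :=
  ∀ u, SendsBlock b l q u (X lo) → ∀ e, lo ≤ e → e < hi → e < m → DecodesBlock b l q u (Y e)

/-- The level-`l` blocks that make up the level-`(l + 1)` block `x`, where the pair `(a, q)` stands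
for block `q` of the stream in segment `a` of the chain. -/
def subBlocks (b t : ℕ → ℕ) (l : ℕ) (x : ℕ × ℕ) : Finset (ℕ × ℕ) :=
  Finset.Ico (x.1 * t (l + 1)) ((x.1 + 1) * t (l + 1)) ×ˢ
    Finset.Ico (x.2 * (b (l + 1) + redundancy (b (l + 1))))
      ((x.2 + 1) * (b (l + 1) + redundancy (b (l + 1))))

/-- The level-`l` block `x` is corrupted, when `F (j, s)` says that channel `j` flips bit `s` of the
stream: at level `0`, this bit is flipped; at a positive level, at least two of the blocks of the
next lower level are corrupted. -/
def Corrupt (b t : ℕ → ℕ) (F : ℕ × ℕ → Prop) : ℕ → ℕ × ℕ → Prop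
  | 0, x => F x
  | l + 1, x => {y | y ∈ subBlocks b t l x ∧ Corrupt b t F l y}.Nontrivial

section Propagation

variable {b t : ℕ → ℕ} {X Y : ℕ → ℕ → ZMod 2} {m S l a q : ℕ}

theorem SendsBlock.subMessage {u x : ℕ → ZMod 2} (h : SendsBlock b (l + 1) q u x) {c : ℕ}
    (hc : c < b (l + 1) + redundancy (b (l + 1))) :
    SendsBlock b l (q * (b (l + 1) + redundancy (b (l + 1))) + c) (subMessage b l u c) x := by
  intro s hs
  rw [← block_encode_succ u c hs, ← block_block, ← codeLen_succ]
  refine h _ ?_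
  rw [codeLen_succ]
  exact mul_add_lt_mul hc hs

theorem decodesBlock_succ {u y : ℕ → ZMod 2}
    (h : {c | c < b (l + 1) + redundancy (b (l + 1)) ∧
      ¬ DecodesBlock b l (q * (b (l + 1) + redundancy (b (l + 1))) + c)
        (subMessage b l u c) y}.Subsingleton) :
    DecodesBlock b (l + 1) q u y := by
  intro i hi
  rw [msgLen_succ] at hi
  have hpos : 0 < msgLen b l := Nat.pos_of_mul_pos_left (Nat.zero_lt_of_lt hi)
  have hmod : i % msgLen b l < msgLen b l := Nat.mod_lt _ hpos
  have errors_subsingleton : {c | c < b (l + 1) + redundancy (b (l + 1)) ∧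
      decode b l (block (codeLen b l) c (block (codeLen b (l + 1)) q y)) (i % msgLen b l) ≠
        subMessage b l u c (i % msgLen b l)}.Subsingleton := by
    refine h.anti fun c ⟨hc, hne⟩ => ⟨hc, fun hdec => hne ?_⟩
    rw [codeLen_succ, block_block]
    exact hdec _ hmod
  calc decode b (l + 1) (block (codeLen b (l + 1)) q y) i
      = block (msgLen b l) (i / msgLen b l) u (i % msgLen b l) :=
        hammingDecode_eq_of_subsingleton_errors errors_subsingleton
          ((Nat.div_lt_iff_lt_mul hpos).2 hi)
    _ = u i := congrArg u (Nat.div_add_mod' i _)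

theorem Transmits.trans {lo mid hi : ℕ} (hfst : Transmits b X Y m l q lo mid)
    (hsnd : Transmits b X Y m l q mid hi) (hrel : IsRelayed b t X Y m S) (hlo : lo < mid)
    (hlevel : level t mid = l) (hS : (q + 1) * codeLen b l ≤ S) :
    Transmits b X Y m l q lo hi := by
  intro u hu e hlo_e he_hi hem
  rcases lt_or_ge e mid with he | he
  · exact hfst u hu e hlo_e he hem
  obtain ⟨j, rfl⟩ := Nat.exists_eq_add_one_of_ne_zero (Nat.ne_zero_of_lt hlo)
  refine hsnd u (fun s hs => ?_) e he he_hi hem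
  subst hlevel
  rw [hrel j (by omega) q hS s hs]
  exact encode_congr (hfst u hu j (by omega) (by omega) (by omega)) hs

theorem transmits_hopLen_succ (ht : ∀ i, 1 ≤ i → 2 ≤ t i) (hrel : IsRelayed b t X Y m S)
    (hS : (q + 1) * codeLen b l ≤ S)
    (h : ∀ i < t (l + 1), Transmits b X Y m l q ((a * t (l + 1) + i) * hopLen t l)
      ((a * t (l + 1) + i + 1) * hopLen t l)) :
    Transmits b X Y m l q (a * hopLen t (l + 1)) ((a + 1) * hopLen t (l + 1)) := by
  have hpos := hopLen_pos ht l
  have transmits_prefix (n : ℕ) (hn : 1 ≤ n) : n ≤ t (l + 1) →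
      Transmits b X Y m l q (a * t (l + 1) * hopLen t l) ((a * t (l + 1) + n) * hopLen t l) := by
    induction n, hn using Nat.le_induction with
    | base => exact h 0
    | succ n hn ih =>
      intro hnt
      exact (ih (by omega)).trans (h n hnt) hrel (Nat.mul_lt_mul_of_pos_right (by omega) hpos)
        (level_mul_hopLen ht hn hnt) hS
  have := transmits_prefix (t (l + 1)) (one_le_two.trans (ht _ (by omega))) le_rfl
  rwa [hopLen_succ, ← mul_assoc, ← mul_assoc, add_one_mul]

theorem mem_subBlocks {i c : ℕ} (hi : i < t (l + 1))
    (hc : c < b (l + 1) + redundancy (b (l + 1))) :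
    (a * t (l + 1) + i, q * (b (l + 1) + redundancy (b (l + 1))) + c) ∈
      subBlocks b t l (a, q) := by
  simp only [subBlocks, Finset.mem_product, Finset.mem_Ico, add_one_mul]
  omega

theorem transmits_of_not_corrupt (ht : ∀ i, 1 ≤ i → 2 ≤ t i) (hrel : IsRelayed b t X Y m S)
    (hS : (q + 1) * codeLen b l ≤ S) (h : ¬ Corrupt b t (fun x => Y x.1 x.2 ≠ X x.1 x.2) l (a, q)) :
    Transmits b X Y m l q (a * hopLen t l) ((a + 1) * hopLen t l) := by
  induction l generalizing a q with
  | zero =>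
    intro u hu e hae hea _ i hi
    rw [hopLen_zero, mul_one] at hae hea
    rw [hopLen_zero, mul_one] at hu
    rw [msgLen_zero, Nat.lt_one_iff] at hi
    obtain rfl : e = a := by omega
    have hsend := hu 0 (codeLen_pos b 0)
    subst hi
    simp only [block, codeLen_zero, mul_one, add_zero, encode] at hsend
    simpa only [decode, block, codeLen_zero, mul_one, add_zero, ← hsend] using not_not.1 h
  | succ l ih =>
    intro u hu e hae hea hem
    refine decodesBlock_succ ?_
    rw [codeLen_succ, ← mul_assoc] at hS
    set B := b (l + 1) + redundancy (b (l + 1))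
    have exists_corrupt {c : ℕ} (hc : c < B)
        (hne : ¬ DecodesBlock b l (q * B + c) (subMessage b l u c) (Y e)) :
        ∃ i < t (l + 1), Corrupt b t (fun x => Y x.1 x.2 ≠ X x.1 x.2) l
          (a * t (l + 1) + i, q * B + c) := by
      by_contra! hgood
      have hSc : (q * B + c + 1) * codeLen b l ≤ S :=
        (Nat.mul_le_mul_right _ (by rw [add_one_mul]; omega)).trans hS
      exact hne (transmits_hopLen_succ ht hrel hSc (fun i hi => ih hSc (hgood i hi)) _
        (hu.subMessage hc) e hae hea hem)
    rintro c ⟨hc, hcne⟩ c' ⟨hc', hcne'⟩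
    obtain ⟨i, hi, hcorrupt⟩ := exists_corrupt hc hcne
    obtain ⟨i', hi', hcorrupt'⟩ := exists_corrupt hc' hcne'
    have heq := Set.not_nontrivial_iff.1 h ⟨mem_subBlocks hi hc, hcorrupt⟩
      ⟨mem_subBlocks hi' hc', hcorrupt'⟩
    exact Nat.add_left_cancel (congrArg Prod.snd heq)

end Propagation

/-! ### The streams of the protocol -/

theorem le_topLevel_of_hopLen_lt (b : ℕ → ℕ) {t : ℕ → ℕ} (ht : ∀ i, 1 ≤ i → 2 ≤ t i) {l m : ℕ}
    (h : hopLen t l < m) (k : ℕ) : l ≤ topLevel b t m k :=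
  calc l ≤ level t (hopLen t l) := le_level ht (hopLen_pos ht l) dvd_rfl
    _ ≤ maxRelayLevel t m :=
      Finset.le_sup (f := level t) (Finset.mem_Icc.2 ⟨hopLen_pos ht l, by omega⟩)
    _ ≤ topLevel b t m k := le_max_right _ _

theorem le_hopLen_topLevel_succ (b : ℕ → ℕ) {t : ℕ → ℕ} (ht : ∀ i, 1 ≤ i → 2 ≤ t i) (m k : ℕ) :
    m ≤ hopLen t (topLevel b t m k + 1) := by
  by_contra! h
  exact (le_topLevel_of_hopLen_lt b ht h k).not_gt (Nat.lt_succ_self _)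

theorem delay_succ (b t : ℕ → ℕ) (j : ℕ) :
    delay b t (j + 1) = delay b t j + codeLen b (level t (j + 1)) :=
  Finset.sum_Icc_succ_top (by omega) _

theorem monotone_delay (b t : ℕ → ℕ) : Monotone (delay b t) :=
  monotone_nat_of_le_succ fun j => by rw [delay_succ]; omega

theorem delay_add_lt {b t : ℕ → ℕ} {m k j s : ℕ} (hj : j < m)
    (hs : s < numBlocks b t m k * codeLen b (topLevel b t m k)) :
    delay b t j + s < transmissionTime b t m k :=
  add_lt_add_of_le_of_lt (monotone_delay b t (Nat.le_sub_one_of_lt hj)) hs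

/-- The input of channel `j` at time step `i`, i.e. what node `j` sends. -/
def Protocol.sent {k m n : ℕ} (P : Protocol k m n) (msg : Fin k → ZMod 2)
    (z : Fin m × Fin n → Bool) : (j : ℕ) → j < m → Fin n → ZMod 2
  | 0, _, i => P.encoder msg i
  | j + 1, h, i =>
      P.relay ⟨j + 1, h⟩ i
        fun i' => P.received msg z j (Nat.lt_of_succ_lt h) ⟨i', i'.isLt.trans i.isLt⟩

theorem Protocol.received_eq_sent_add_flipBit {k m n : ℕ} (P : Protocol k m n)
    (msg : Fin k → ZMod 2) (z : Fin m × Fin n → Bool) (j : ℕ) (h : j < m) (i : Fin n) :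
    P.received msg z j h i = P.sent msg z j h i + flipBit (z (⟨j, h⟩, i)) := by
  cases j <;> rfl

section Stream

variable {b t : ℕ → ℕ} {m k : ℕ}

/-- The bits `g j i` of channel `j` at time step `i`, counted from the first meaningful bit of the
channel (and `0` where there is no such channel or time step). -/
def stream (g : (j : ℕ) → j < m → Fin (transmissionTime b t m k) → ZMod 2) (j s : ℕ) : ZMod 2 :=
  if h : j < m ∧ delay b t j + s < transmissionTime b t m k then g j h.1 ⟨delay b t j + s, h.2⟩
  else 0

theorem stream_of_lt (g : (j : ℕ) → j < m → Fin (transmissionTime b t m k) → ZMod 2) {j s : ℕ}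
    (hj : j < m) (hs : s < numBlocks b t m k * codeLen b (topLevel b t m k)) :
    stream g j s = g j hj ⟨delay b t j + s, delay_add_lt hj hs⟩ :=
  dif_pos ⟨hj, delay_add_lt hj hs⟩

variable (msg : Fin k → ZMod 2) (z : Fin m × Fin (transmissionTime b t m k) → Bool)

/-- The stream of bits that node `j` sends. -/
noncomputable def sentStream : ℕ → ℕ → ZMod 2 :=
  stream ((multiBitProtocol b t m k).sent msg z)

/-- The stream of bits that node `j + 1` receives. -/
noncomputable def receivedStream : ℕ → ℕ → ZMod 2 :=
  stream ((multiBitProtocol b t m k).received msg z)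

/-- Top-level block `q` of the message that is padded with zeros. -/
def messageBlock (b t : ℕ → ℕ) (m q : ℕ) : ℕ → ZMod 2 :=
  block (msgLen b (topLevel b t m k)) q fun d => if h : d < k then msg ⟨d, h⟩ else 0

theorem sendsBlock_sentStream_zero (hm : 0 < m) {q : ℕ} (hq : q < numBlocks b t m k) :
    SendsBlock b (topLevel b t m k) q (messageBlock msg b t m q) (sentStream msg z 0) := by
  intro s hs
  have delay_zero : delay b t 0 = 0 := by simp [delay]
  rw [block, sentStream, stream_of_lt _ hm (mul_add_lt_mul hq hs)]
  simp only [Protocol.sent, multiBitProtocol, delay_zero, zero_add, mul_add_div_of_lt q hs,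
    Nat.mul_add_mod_of_lt hs]
  rfl

theorem isRelayed_sentStream :
    IsRelayed b t (sentStream msg z) (receivedStream msg z) m
      (numBlocks b t m k * codeLen b (topLevel b t m k)) := by
  intro j hj q hq s hs
  set N := codeLen b (level t (j + 1)) with hN
  have lt_of_lt {s : ℕ} (hs : s < N) :
      q * N + s < numBlocks b t m k * codeLen b (topLevel b t m k) := by
    rw [add_one_mul] at hq; omega
  rw [block, sentStream, stream_of_lt _ hj (lt_of_lt hs)]
  simp only [Protocol.sent, multiBitProtocol, Nat.add_sub_cancel_left, Nat.add_sub_cancel, ← hN,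
    mul_add_div_of_lt q hs, Nat.mul_add_mod_of_lt hs]
  rw [if_neg (by omega)]
  refine encode_congr (fun x hx => decode_congr (fun s' hs' => ?_) hx) hs
  have received_before : delay b t j + q * N + s' < delay b t (j + 1) + (q * N + s) := by
    rw [delay_succ, ← hN]; omega
  rw [dif_pos received_before, block, receivedStream,
    stream_of_lt _ (Nat.lt_of_succ_lt hj) (lt_of_lt hs')]
  simp only [multiBitProtocol, add_assoc]

theorem estimate_eq_of_decodesBlock (hb : ∀ i, 1 ≤ i → 2 ≤ b i) (hm : 0 < m)
    (h : ∀ q < numBlocks b t m k, DecodesBlock b (topLevel b t m k) q (messageBlock msg b t m q)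
      (receivedStream msg z (m - 1))) :
    (multiBitProtocol b t m k).estimate hm msg z = msg := by
  funext d
  set M := topLevel b t m k with hM
  have hpos : 0 < msgLen b M := msgLen_pos hb M
  have hmod : (d : ℕ) % msgLen b M < msgLen b M := Nat.mod_lt _ hpos
  have hq : (d : ℕ) / msgLen b M < numBlocks b t m k := by
    rw [Nat.div_lt_iff_lt_mul hpos, mul_comm]
    exact d.isLt.trans_le (le_smul_ceilDiv hpos)
  have message_eq : messageBlock msg b t m (d / msgLen b M) (d % msgLen b M) = msg d := by
    simp only [messageBlock, block, ← hM, Nat.div_add_mod', d.isLt, dif_pos]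
  rw [← message_eq, ← h _ hq _ hmod]
  simp only [Protocol.estimate, multiBitProtocol, ← hM]
  refine decode_congr (fun s hs => ?_) hmod
  have hlt := mul_add_lt_mul hq hs
  rw [dif_pos (by rw [add_assoc]; exact delay_add_lt (by omega) hlt), block, receivedStream,
    stream_of_lt _ (by omega) hlt]
  simp only [multiBitProtocol, add_assoc, ← hM]

theorem estimate_eq_of_not_corrupt (hb : ∀ i, 1 ≤ i → 2 ≤ b i) (ht : ∀ i, 1 ≤ i → 2 ≤ t i)
    (hm : 0 < m)
    (h : ∀ a < t (topLevel b t m k + 1), ∀ q < numBlocks b t m k,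
      ¬ Corrupt b t (fun x => receivedStream msg z x.1 x.2 ≠ sentStream msg z x.1 x.2)
        (topLevel b t m k) (a, q)) :
    (multiBitProtocol b t m k).estimate hm msg z = msg := by
  refine estimate_eq_of_decodesBlock msg z hb hm fun q hq => ?_
  have hrel := isRelayed_sentStream msg z
  have hS : (q + 1) * codeLen b (topLevel b t m k) ≤
      numBlocks b t m k * codeLen b (topLevel b t m k) := Nat.mul_le_mul_right _ hq
  have transmits := transmits_hopLen_succ (a := 0) ht hrel hS fun i hi =>
    transmits_of_not_corrupt ht hrel hS (h _ (by rwa [zero_mul, zero_add]) q hq)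
  rw [zero_mul, zero_add, one_mul] at transmits
  exact transmits _ (sendsBlock_sentStream_zero msg z hm hq) (m - 1) (Nat.zero_le _)
    (by have := le_hopLen_topLevel_succ b ht m k; omega) (by omega)

end Stream

/-! ### The probability of a corrupted block -/

/-- Local stochastic noise: the probability that all sites of a finite set are faulty, where
`F ω x` says that site `x` is, is at most `ε` to the number of sites. -/
def IsLocallyStochastic {Ω ι : Type*} [MeasurableSpace Ω] (μ : Measure Ω) (F : Ω → ι → Prop)
    (ε : ℝ) : Prop :=
  ∀ s : Finset ι, μ.real {ω | ∀ x ∈ s, F ω x} ≤ ε ^ s.card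

theorem IsLocallyStochastic.measureReal_le {Ω ι : Type*} [MeasurableSpace Ω] {μ : Measure Ω}
    {F : Ω → ι → Prop} {ε : ℝ} (h : IsLocallyStochastic μ F ε) (x : ι) :
    μ.real {ω | F ω x} ≤ ε := by
  simpa using h {x}

theorem card_biUnion_pair {ι κ : Type*} [DecidableEq ι] [Fintype κ] {D : κ → Finset ι}
    (hD : Pairwise (Function.onFun Disjoint D)) {g : κ → ι × ι} (hg : ∀ x, g x ∈ (D x).offDiag) :
    (Finset.univ.biUnion fun x => {(g x).1, (g x).2}).card = 2 * Fintype.card κ := by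
  simp only [Finset.mem_offDiag] at hg
  have pair_subset (x : κ) : {(g x).1, (g x).2} ⊆ D x :=
    Finset.insert_subset (hg x).1 (Finset.singleton_subset_iff.2 (hg x).2.1)
  rw [Finset.card_biUnion fun x _ x' _ hne => (hD hne).mono (pair_subset x) (pair_subset x'),
    Finset.sum_congr rfl fun x _ => Finset.card_pair (hg x).2.2]
  simp [mul_comm]

theorem IsLocallyStochastic.nontrivial {Ω ι κ : Type*} [MeasurableSpace Ω]
    {μ : Measure Ω} [IsFiniteMeasure μ] {F : Ω → ι → Prop} {ε : ℝ}
    (h : IsLocallyStochastic μ F ε) (hε : 0 ≤ ε) {D : κ → Finset ι}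
    (hD : Pairwise (Function.onFun Disjoint D)) {n : ℕ} (hn : ∀ x, (D x).card ≤ n) :
    IsLocallyStochastic μ (fun ω x => {y | y ∈ D x ∧ F ω y}.Nontrivial) (n ^ 2 * ε ^ 2) := by
  classical
  intro s
  let pairs := Fintype.piFinset fun x : s => (D x).offDiag
  let sites (g : s → ι × ι) : Finset ι := Finset.univ.biUnion fun x => {(g x).1, (g x).2}
  have event_subset : {ω | ∀ x ∈ s, {y | y ∈ D x ∧ F ω y}.Nontrivial} ⊆
      ⋃ g ∈ pairs, {ω | ∀ y ∈ sites g, F ω y} := by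
    intro ω hω
    choose y hy y' hy' hne using fun x : s => hω x x.2
    refine Set.mem_biUnion (x := fun x => (y x, y' x)) ?_ ?_
    · exact Fintype.mem_piFinset.2 fun x => Finset.mem_offDiag.2 ⟨(hy x).1, (hy' x).1, hne x⟩
    · simp only [Set.mem_ofPred_eq, sites, Finset.mem_biUnion, Finset.mem_insert,
        Finset.mem_singleton]
      rintro _ ⟨x, -, rfl | rfl⟩
      · exact (hy x).2
      · exact (hy' x).2
  have card_sites {g : s → ι × ι} (hg : g ∈ pairs) : (sites g).card = 2 * s.card := by
    rw [card_biUnion_pair (hD.comp_of_injective Subtype.val_injective) (Fintype.mem_piFinset.1 hg),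
      Fintype.card_coe]
  have card_pairs : pairs.card ≤ (n ^ 2) ^ s.card := by
    rw [Fintype.card_piFinset, ← Fintype.card_coe s]
    refine Finset.prod_le_pow_card _ _ _ fun x _ => ?_
    rw [Finset.offDiag_card, sq]
    exact (Nat.sub_le _ _).trans (Nat.mul_le_mul (hn x) (hn x))
  calc μ.real {ω | ∀ x ∈ s, {y | y ∈ D x ∧ F ω y}.Nontrivial}
      ≤ ∑ g ∈ pairs, μ.real {ω | ∀ y ∈ sites g, F ω y} :=
        (measureReal_mono event_subset (measure_ne_top _ _)).trans
          (measureReal_biUnion_finset_le _ _)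
    _ ≤ ∑ _g ∈ pairs, ε ^ (2 * s.card) :=
        Finset.sum_le_sum fun g hg => card_sites hg ▸ h (sites g)
    _ ≤ (n ^ 2) ^ s.card * ε ^ (2 * s.card) := by
        rw [Finset.sum_const, nsmul_eq_mul]
        exact mul_le_mul_of_nonneg_right (by exact_mod_cast card_pairs) (by positivity)
    _ = (n ^ 2 * ε ^ 2) ^ s.card := by rw [mul_pow, pow_mul]

theorem card_subBlocks (b t : ℕ → ℕ) (l : ℕ) (x : ℕ × ℕ) :
    (subBlocks b t l x).card = t (l + 1) * (b (l + 1) + redundancy (b (l + 1))) := by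
  simp [subBlocks, add_mul]

theorem pairwise_disjoint_subBlocks (b t : ℕ → ℕ) (l : ℕ) :
    Pairwise (Function.onFun Disjoint (subBlocks b t l)) := by
  refine fun x x' hne => Finset.disjoint_left.2 fun y hy hy' => hne ?_
  simp only [subBlocks, Finset.mem_product, Finset.mem_Ico] at hy hy'
  exact Prod.ext
    ((Nat.div_eq_of_lt_le hy.1.1 hy.1.2).symm.trans (Nat.div_eq_of_lt_le hy'.1.1 hy'.1.2))
    ((Nat.div_eq_of_lt_le hy.2.1 hy.2.2).symm.trans (Nat.div_eq_of_lt_le hy'.2.1 hy'.2.2))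

/-- The bound for the probability that a level-`l` block is corrupted, if a bit is flipped with
probability `p`: the union bound over the pairs of sub-blocks. -/
noncomputable def corruptBound (b t : ℕ → ℕ) (p : ℝ) : ℕ → ℝ
  | 0 => p
  | l + 1 => (t (l + 1) * (b (l + 1) + redundancy (b (l + 1))) : ℕ) ^ 2 * corruptBound b t p l ^ 2

theorem corruptBound_nonneg (b t : ℕ → ℕ) {p : ℝ} (hp : 0 ≤ p) : ∀ l, 0 ≤ corruptBound b t p l
  | 0 => hp
  | l + 1 => by unfold corruptBound; positivity

theorem IsLocallyStochastic.corrupt {Ω : Type*} [MeasurableSpace Ω] {μ : Measure Ω}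
    [IsFiniteMeasure μ] {F : Ω → ℕ × ℕ → Prop} {p : ℝ} (hp : 0 ≤ p)
    (h : IsLocallyStochastic μ F p) (b t : ℕ → ℕ) (l : ℕ) :
    IsLocallyStochastic μ (fun ω => Corrupt b t (F ω) l) (corruptBound b t p l) := by
  induction l with
  | zero => exact h
  | succ l ih =>
    exact ih.nontrivial (corruptBound_nonneg b t hp l) (pairwise_disjoint_subBlocks b t l)
      fun x => (card_subBlocks b t l x).le

instance (m n : ℕ) (p : unitInterval) : IsProbabilityMeasure (noise m n p) := by
  unfold noise; infer_instance

theorem noise_real_forall_mem_eq_true {m n : ℕ} (p : unitInterval) (s : Finset (Fin m × Fin n)) :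
    (noise m n p).real {z | ∀ x ∈ s, z x = true} = (p : ℝ) ^ s.card := by
  have event_eq_pi : {z : Fin m × Fin n → Bool | ∀ x ∈ s, z x = true} =
      (s : Set (Fin m × Fin n)).pi fun _ => {true} := by
    ext; simp
  have prob_flip : (bernoulliMeasure true false p).real {true} = p :=
    bernoulliMeasure_real_apply_of_mem_of_notMem p (by simp) (by simp) (by simp)
  rw [event_eq_pi, noise, measureReal_def, Measure.pi_pi_finset, ENNReal.toReal_prod,
    ← measureReal_def, prob_flip, Finset.prod_const]

theorem exists_flip_of_receivedStream_ne {b t : ℕ → ℕ} {m k : ℕ} {msg : Fin k → ZMod 2}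
    {z : Fin m × Fin (transmissionTime b t m k) → Bool} {j s : ℕ}
    (h : receivedStream msg z j s ≠ sentStream msg z j s) :
    ∃ i : Fin m × Fin (transmissionTime b t m k),
      (i.1 : ℕ) = j ∧ (i.2 : ℕ) = delay b t j + s ∧ z i = true := by
  unfold receivedStream sentStream stream at h
  split_ifs at h with hlt
  · rw [Protocol.received_eq_sent_add_flipBit] at h
    refine ⟨(⟨j, hlt.1⟩, ⟨delay b t j + s, hlt.2⟩), rfl, rfl, ?_⟩
    by_contra hz
    exact h (by simp [flipBit, hz])
  · exact absurd rfl h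

theorem isLocallyStochastic_noise (b t : ℕ → ℕ) (m k : ℕ) (msg : Fin k → ZMod 2)
    (p : unitInterval) :
    IsLocallyStochastic (noise m (transmissionTime b t m k) p)
      (fun z (x : ℕ × ℕ) => receivedStream msg z x.1 x.2 ≠ sentStream msg z x.1 x.2) p := by
  intro s
  rcases Set.eq_empty_or_nonempty {z : Fin m × Fin (transmissionTime b t m k) → Bool |
    ∀ x ∈ s, receivedStream msg z x.1 x.2 ≠ sentStream msg z x.1 x.2} with hempty | ⟨z₀, hz₀⟩
  · rw [hempty, measureReal_empty]
    exact pow_nonneg p.2.1 _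
  choose site fst_site snd_site _ using fun x : s => exists_flip_of_receivedStream_ne (hz₀ x x.2)
  have site_injective : Function.Injective site := fun x x' heq => by
    have fst_eq : (x : ℕ × ℕ).1 = (x' : ℕ × ℕ).1 := by rw [← fst_site, ← fst_site, heq]
    have snd_eq : delay b t x.1.1 + x.1.2 = delay b t x'.1.1 + x'.1.2 := by
      rw [← snd_site, ← snd_site, heq]
    exact Subtype.ext (Prod.ext fst_eq (by rwa [fst_eq, Nat.add_left_cancel_iff] at snd_eq))
  have card_image : (Finset.univ.image site).card = s.card := by
    rw [Finset.card_image_of_injective _ site_injective, Finset.card_univ, Fintype.card_coe]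
  rw [← card_image, ← noise_real_forall_mem_eq_true]
  refine measureReal_mono fun z hz => Finset.forall_mem_image.2 fun x _ => ?_
  obtain ⟨i, fst_eq, snd_eq, hi⟩ := exists_flip_of_receivedStream_ne (hz x x.2)
  rwa [show site x = i from Prod.ext (Fin.ext ((fst_site x).trans fst_eq.symm))
    (Fin.ext ((snd_site x).trans snd_eq.symm))]

theorem lt_msgLen_msgLevel_succ {b : ℕ → ℕ} (hb : ∀ i, 1 ≤ i → 2 ≤ b i) (k : ℕ) :
    k < msgLen b (msgLevel b k + 1) := by
  by_contra! hle
  exact (Nat.le_findGreatest ((strictMono_msgLen hb).le_apply.trans hle) hle).not_gt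
    (Nat.lt_succ_self _)

theorem numBlocks_le {b : ℕ → ℕ} (hb : ∀ i, 1 ≤ i → 2 ≤ b i) (t : ℕ → ℕ) (m k : ℕ) :
    numBlocks b t m k ≤ b (topLevel b t m k + 1) := by
  rw [numBlocks, ceilDiv_le_iff_le_smul (msgLen_pos hb _), smul_eq_mul, mul_comm, ← msgLen_succ]
  exact (lt_msgLen_msgLevel_succ hb k).le.trans
    ((strictMono_msgLen hb).monotone (Nat.succ_le_succ (le_max_left _ _)))

theorem errorProb_le {b t : ℕ → ℕ} (hb : ∀ i, 1 ≤ i → 2 ≤ b i) (ht : ∀ i, 1 ≤ i → 2 ≤ t i)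
    {m k : ℕ} (hm : 0 < m) (p : unitInterval) (msg : Fin k → ZMod 2) :
    (multiBitProtocol b t m k).errorProb hm p msg ≤
      t (topLevel b t m k + 1) * b (topLevel b t m k + 1) *
        corruptBound b t p (topLevel b t m k) := by
  set M := topLevel b t m k
  let F (z : Fin m × Fin (transmissionTime b t m k) → Bool) (x : ℕ × ℕ) : Prop :=
    receivedStream msg z x.1 x.2 ≠ sentStream msg z x.1 x.2
  have corrupt_prob_le := (isLocallyStochastic_noise b t m k msg p).corrupt p.2.1 b t M
  let topBlocks := Finset.range (t (M + 1)) ×ˢ Finset.range (numBlocks b t m k)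
  have error_subset : {z | (multiBitProtocol b t m k).estimate hm msg z ≠ msg} ⊆
      ⋃ x ∈ topBlocks, {z | Corrupt b t (F z) M x} := by
    intro z hz
    by_contra hgood
    refine hz (estimate_eq_of_not_corrupt msg z hb ht hm fun a ha q hq hcorrupt => hgood ?_)
    exact Set.mem_biUnion (Finset.mem_product.2 ⟨Finset.mem_range.2 ha, Finset.mem_range.2 hq⟩)
      hcorrupt
  calc (multiBitProtocol b t m k).errorProb hm p msg
      ≤ ∑ x ∈ topBlocks,
          (noise m (transmissionTime b t m k) p).real {z | Corrupt b t (F z) M x} :=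
        (measureReal_mono error_subset (measure_ne_top _ _)).trans
          (measureReal_biUnion_finset_le _ _)
    _ ≤ ∑ _x ∈ topBlocks, corruptBound b t p M :=
        Finset.sum_le_sum fun x _ => corrupt_prob_le.measureReal_le x
    _ = t (M + 1) * numBlocks b t m k * corruptBound b t p M := by simp [topBlocks]
    _ ≤ t (M + 1) * b (M + 1) * corruptBound b t p M := by
        have := corruptBound_nonneg b t p.2.1 M
        gcongr
        exact numBlocks_le hb t m k

theorem two_le_tSeq (i : ℕ) (hi : 1 ≤ i) : 2 ≤ tSeq i := by
  unfold tSeq; nlinarith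

theorem two_le_bSeq (i : ℕ) (hi : 1 ≤ i) : 2 ≤ bSeq i := by
  have : 3 ^ 2 ≤ (i + 2) ^ 2 := Nat.pow_le_pow_left (by omega) 2
  unfold bSeq; omega

theorem bSeq_add_redundancy_le (i : ℕ) (hi : 1 ≤ i) :
    9 * (bSeq i + redundancy (bSeq i)) ≤ 5 * tSeq i := by
  obtain rfl | hi := hi.eq_or_lt
  · have bSeq_one : bSeq 1 = 2 := rfl
    have clog_two : Nat.clog 2 2 = 1 := Nat.clog_eq_one le_rfl le_rfl
    simp [bSeq_one, redundancy, clog_two, tSeq]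
  · have four_mul_le : 4 * bSeq i ≤ tSeq i := Nat.mul_div_le _ _
    have four_le : 4 ≤ bSeq i :=
      (Nat.le_div_iff_mul_le (by norm_num)).2 (Nat.pow_le_pow_left (by omega : 4 ≤ i + 2) 2)
    have := redundancy_le_self (by omega : 3 ≤ bSeq i)
    omega

-- The base case is exactly the threshold `3⁻⁸ / 4`. A block of level `l + 1` has at most
-- `5 / 9 * (l + 3) ^ 4` sub-blocks, and the square of this number is absorbed by the exponent `8`.
theorem corruptBound_le {p : ℝ} (hp₀ : 0 ≤ p) (hp : p ≤ (3 : ℝ) ^ (-8 : ℤ) / 4) (l : ℕ) :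
    corruptBound bSeq tSeq p l ≤ 1 / (4 * ((l : ℝ) + 3) ^ 8) := by
  induction l with
  | zero => exact hp.trans_eq (by norm_num)
  | succ l ih =>
    set s : ℝ := (l : ℝ) + 3 with hs
    have hs₃ : 3 ≤ s := by simp [hs]
    have card_le : ((tSeq (l + 1) * (bSeq (l + 1) + redundancy (bSeq (l + 1))) : ℕ) : ℝ) ≤
        5 / 9 * s ^ 4 := by
      have h : (9 * (bSeq (l + 1) + redundancy (bSeq (l + 1))) : ℝ) ≤ 5 * tSeq (l + 1) := by
        exact_mod_cast bSeq_add_redundancy_le (l + 1) (by omega)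
      have tSeq_eq : (tSeq (l + 1) : ℝ) = s ^ 2 := by rw [tSeq, hs]; push_cast; ring
      rw [tSeq_eq] at h
      push_cast
      rw [tSeq_eq]
      nlinarith [sq_nonneg s]
    have succ_pow_le : (s + 1) ^ 8 ≤ 10 * s ^ 8 :=
      calc (s + 1) ^ 8 ≤ (4 / 3 * s) ^ 8 := by gcongr; linarith
        _ = (4 / 3) ^ 8 * s ^ 8 := mul_pow _ _ _
        _ ≤ 10 * s ^ 8 := by gcongr; norm_num
    calc corruptBound bSeq tSeq p (l + 1)
        ≤ (5 / 9 * s ^ 4) ^ 2 * (1 / (4 * s ^ 8)) ^ 2 := by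
          have := corruptBound_nonneg bSeq tSeq hp₀ l
          unfold corruptBound
          gcongr
      _ = 25 / 324 / (4 * s ^ 8) := by field_simp; norm_num
      _ ≤ 1 / 10 / (4 * s ^ 8) := div_le_div_of_nonneg_right (by norm_num) (by positivity)
      _ = 1 / (4 * (10 * s ^ 8)) := by rw [div_div, mul_left_comm]
      _ ≤ 1 / (4 * (s + 1) ^ 8) := by gcongr
      _ = 1 / (4 * (((l + 1 : ℕ) : ℝ) + 3) ^ 8) := by rw [hs]; push_cast; ring

theorem errorProb_multiBitProtocol_le {m k : ℕ} (hm : 0 < m) {p : unitInterval}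
    (hp : (p : ℝ) ≤ (3 : ℝ) ^ (-8 : ℤ) / 4) (msg : Fin k → ZMod 2) :
    (multiBitProtocol bSeq tSeq m k).errorProb hm p msg ≤
      1 / ((topLevel bSeq tSeq m k : ℝ) + 1) := by
  set M := topLevel bSeq tSeq m k
  have tSeq_eq : (tSeq (M + 1) : ℝ) = ((M : ℝ) + 3) ^ 2 := by rw [tSeq]; push_cast; ring
  have bSeq_le : (bSeq (M + 1) : ℝ) ≤ ((M : ℝ) + 3) ^ 2 := by
    rw [← tSeq_eq]
    exact_mod_cast Nat.div_le_self _ _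
  calc (multiBitProtocol bSeq tSeq m k).errorProb hm p msg
      ≤ tSeq (M + 1) * bSeq (M + 1) * corruptBound bSeq tSeq p M :=
        errorProb_le two_le_bSeq two_le_tSeq hm p msg
    _ ≤ ((M : ℝ) + 3) ^ 2 * ((M : ℝ) + 3) ^ 2 * (1 / (4 * ((M : ℝ) + 3) ^ 8)) := by
        have := corruptBound_nonneg bSeq tSeq p.2.1 M
        rw [tSeq_eq]
        gcongr
        exact corruptBound_le p.2.1 hp M
    _ = 1 / (4 * ((M : ℝ) + 3) ^ 4) := by field_simp
    _ ≤ 1 / ((M : ℝ) + 1) := by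
        have : (M : ℝ) + 3 ≤ ((M : ℝ) + 3) ^ 4 :=
          le_self_pow₀ (by linarith [Nat.cast_nonneg (α := ℝ) M]) (by norm_num)
        gcongr
        linarith

/-! ### The transmission time -/

theorem delay_le_sum (b t : ℕ → ℕ) (n : ℕ) :
    delay b t n ≤ ∑ l ∈ Finset.range (n + 1), codeLen b l * (n / hopLen t l) :=
  calc delay b t n
      ≤ ∑ j ∈ Finset.Ioc 0 n, ∑ l ∈ Finset.range (n + 1),
        if hopLen t l ∣ j then codeLen b l else 0 := by
        refine Finset.sum_le_sum fun j hj => ?_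
        have level_mem : level t j ∈ Finset.range (n + 1) := Finset.mem_range_succ_iff.2
          ((Nat.findGreatest_le j).trans (Finset.mem_Ioc.1 hj).2)
        refine le_trans ?_ (Finset.single_le_sum (fun l _ => Nat.zero_le _) level_mem)
        rw [if_pos (hopLen_level_dvd t j)]
    _ = ∑ l ∈ Finset.range (n + 1), codeLen b l * (n / hopLen t l) := by
        rw [Finset.sum_comm]
        refine Finset.sum_congr rfl fun l _ => ?_
        rw [← Finset.sum_filter, Finset.sum_const, smul_eq_mul, mul_comm,
          Nat.Ioc_filter_dvd_card_eq_div]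

section Rate

variable {b t : ℕ → ℕ} {r : ℝ}

theorem codeLen_le_pow_mul_hopLen
    (h : ∀ i, 1 ≤ i → (b i : ℝ) + redundancy (b i) ≤ r * t i) (l : ℕ) :
    (codeLen b l : ℝ) ≤ r ^ l * hopLen t l := by
  have prod_eq : r ^ l * hopLen t l = ∏ i ∈ Finset.Icc 1 l, r * t i := by
    rw [Finset.prod_mul_distrib, Finset.prod_const, Nat.card_Icc, Nat.add_sub_cancel, hopLen,
      Nat.cast_prod]
  rw [prod_eq, codeLen, Nat.cast_prod]
  exact Finset.prod_le_prod (fun i _ => by positivity) fun i hi =>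
    (Nat.cast_add _ _).trans_le (h i (Finset.mem_Icc.1 hi).1)

theorem delay_le (hr₀ : 0 ≤ r) (hr₁ : r < 1)
    (h : ∀ i, 1 ≤ i → (b i : ℝ) + redundancy (b i) ≤ r * t i) (n : ℕ) :
    (delay b t n : ℝ) ≤ (1 - r)⁻¹ * n :=
  calc (delay b t n : ℝ)
      ≤ ∑ l ∈ Finset.range (n + 1), (codeLen b l : ℝ) * (n / hopLen t l : ℕ) := by
        exact_mod_cast delay_le_sum b t n
    _ ≤ ∑ l ∈ Finset.range (n + 1), r ^ l * n := Finset.sum_le_sum fun l _ =>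
        calc (codeLen b l : ℝ) * (n / hopLen t l : ℕ)
            ≤ r ^ l * hopLen t l * (n / hopLen t l : ℕ) := by
              gcongr
              exact codeLen_le_pow_mul_hopLen h l
          _ = r ^ l * (hopLen t l * (n / hopLen t l) : ℕ) := by push_cast; ring
          _ ≤ r ^ l * n := by gcongr; exact Nat.mul_div_le _ _
    _ ≤ (1 - r)⁻¹ * n := by
        rw [← Finset.sum_mul, ← tsum_geometric_of_lt_one hr₀ hr₁]
        gcongr
        exact (summable_geometric_of_lt_one hr₀ hr₁).sum_le_tsum _ fun l _ => by positivity

theorem exists_codeLen_le_mul_msgLen (hb : ∀ i, 1 ≤ i → 2 ≤ b i)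
    (h : Summable fun i => (redundancy (b i) : ℝ) / b i) :
    ∃ K : ℝ, 0 ≤ K ∧ ∀ l, (codeLen b l : ℝ) ≤ K * msgLen b l := by
  refine ⟨Real.exp (∑' i, (redundancy (b i) : ℝ) / b i), (Real.exp_pos _).le, fun l => ?_⟩
  calc (codeLen b l : ℝ)
      = (∏ i ∈ Finset.Icc 1 l, (1 + (redundancy (b i) : ℝ) / b i)) * msgLen b l := by
        rw [codeLen, msgLen, Nat.cast_prod, Nat.cast_prod, ← Finset.prod_mul_distrib]
        refine Finset.prod_congr rfl fun i hi => ?_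
        have : (b i : ℝ) ≠ 0 := by
          have := hb i (Finset.mem_Icc.1 hi).1
          exact_mod_cast (by omega : b i ≠ 0)
        push_cast
        field_simp
    _ ≤ Real.exp (∑ i ∈ Finset.Icc 1 l, (redundancy (b i) : ℝ) / b i) * msgLen b l := by
        gcongr
        exact Real.prod_one_add_le_exp_sum _ fun i => by positivity
    _ ≤ Real.exp (∑' i, (redundancy (b i) : ℝ) / b i) * msgLen b l := by
        gcongr
        exact h.sum_le_tsum _ fun i _ => by positivity

end Rate

theorem msgLen_msgLevel_le (b : ℕ → ℕ) {k : ℕ} (hk : 0 < k) : msgLen b (msgLevel b k) ≤ k :=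
  Nat.findGreatest_spec (P := fun l => msgLen b l ≤ k) (Nat.zero_le k)
    (by rwa [msgLen_zero, Nat.one_le_iff_ne_zero, ← Nat.pos_iff_ne_zero])

theorem hopLen_maxRelayLevel_le (t : ℕ → ℕ) {m : ℕ} (hm : 0 < m) :
    hopLen t (maxRelayLevel t m) ≤ m := by
  rcases (Finset.Icc 1 (m - 1)).eq_empty_or_nonempty with hempty | hne
  · rwa [maxRelayLevel, hempty, Finset.sup_empty, Nat.bot_eq_zero, hopLen_zero]
  · obtain ⟨j, hj, level_eq⟩ := Finset.exists_mem_eq_sup _ hne (level t)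
    rw [Finset.mem_Icc] at hj
    rw [maxRelayLevel, level_eq]
    exact (Nat.le_of_dvd hj.1 (hopLen_level_dvd t j)).trans (by omega)

theorem numBlocks_mul_codeLen_le {b t : ℕ → ℕ} (hb : ∀ i, 1 ≤ i → 2 ≤ b i) {K : ℝ} (hK₀ : 0 ≤ K)
    (hK : ∀ l, (codeLen b l : ℝ) ≤ K * msgLen b l) (hle : ∀ l, codeLen b l ≤ hopLen t l)
    {m k : ℕ} (hm : 0 < m) (hk : 0 < k) :
    (numBlocks b t m k * codeLen b (topLevel b t m k) : ℝ) ≤ 2 * K * k + m := by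
  set M := topLevel b t m k with hM
  rcases le_or_gt (msgLen b M) k with hMk | hMk
  · have numBlocks_mul_msgLen_le : numBlocks b t m k * msgLen b M ≤ 2 * k := by
      rw [numBlocks, ← hM, Nat.ceilDiv_eq_add_pred_div]
      exact (Nat.div_mul_le_self _ _).trans (by omega)
    calc (numBlocks b t m k * codeLen b M : ℝ)
        ≤ numBlocks b t m k * (K * msgLen b M) := by gcongr; exact hK M
      _ = K * (numBlocks b t m k * msgLen b M : ℕ) := by push_cast; ring
      _ ≤ K * (2 * k : ℕ) := by gcongr
      _ = 2 * K * k := by push_cast; ring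
      _ ≤ 2 * K * k + m := le_add_of_nonneg_right (Nat.cast_nonneg m)
  · have numBlocks_le_one : numBlocks b t m k ≤ 1 := by
      rw [numBlocks, ← hM, ceilDiv_le_iff_le_smul (msgLen_pos hb M), smul_eq_mul, mul_one]
      exact hMk.le
    have top_eq_relay : M = maxRelayLevel t m := by
      refine (max_choice _ _).resolve_left fun top_eq_msg => hMk.not_ge ?_
      rw [hM, topLevel, top_eq_msg]
      exact msgLen_msgLevel_le b hk
    have codeLen_le : codeLen b M ≤ m :=
      (hle M).trans (top_eq_relay ▸ hopLen_maxRelayLevel_le t hm)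
    calc (numBlocks b t m k * codeLen b M : ℝ)
        ≤ 1 * m := by
          gcongr
          · exact_mod_cast numBlocks_le_one
      _ ≤ 2 * K * k + m := by rw [one_mul]; exact le_add_of_nonneg_left (by positivity)

theorem exists_transmissionTime_le {b t : ℕ → ℕ} (hb : ∀ i, 1 ≤ i → 2 ≤ b i) {r : ℝ}
    (hr₀ : 0 ≤ r) (hr₁ : r < 1) (hbt : ∀ i, 1 ≤ i → (b i : ℝ) + redundancy (b i) ≤ r * t i)
    (hsum : Summable fun i => (redundancy (b i) : ℝ) / b i) :
    ∃ C : ℝ, ∀ m k : ℕ, 1 ≤ m → 1 ≤ k → (transmissionTime b t m k : ℝ) ≤ C * (m + k) := by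
  obtain ⟨K, hK₀, hK⟩ := exists_codeLen_le_mul_msgLen hb hsum
  have codeLen_le_hopLen (l : ℕ) : codeLen b l ≤ hopLen t l := by
    have := (codeLen_le_pow_mul_hopLen hbt l).trans
      (mul_le_of_le_one_left (by positivity) (pow_le_one₀ hr₀ hr₁.le))
    exact_mod_cast this
  have : 0 ≤ (1 - r)⁻¹ := inv_nonneg.2 (sub_nonneg.2 hr₁.le)
  refine ⟨(1 - r)⁻¹ + 1 + 2 * K, fun m k hm hk => ?_⟩
  calc (transmissionTime b t m k : ℝ)
      = delay b t (m - 1) + numBlocks b t m k * codeLen b (topLevel b t m k) := by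
        rw [transmissionTime]; push_cast; rfl
    _ ≤ (1 - r)⁻¹ * (m - 1 : ℕ) + (2 * K * k + m) :=
        add_le_add (delay_le hr₀ hr₁ hbt _)
          (numBlocks_mul_codeLen_le hb hK₀ hK codeLen_le_hopLen hm hk)
    _ ≤ (1 - r)⁻¹ * m + (2 * K * k + m) := by gcongr; exact Nat.sub_le _ _
    _ ≤ ((1 - r)⁻¹ + 1 + 2 * K) * (m + k) := by
        have : 0 ≤ ((1 - r)⁻¹ + 1) * k + 2 * K * m := by positivity
        linarith

theorem redundancy_isBigO_rpow {ε : ℝ} (hε : 0 < ε) :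
    (fun n : ℕ => (redundancy n : ℝ)) =O[Filter.atTop] fun n : ℕ => (n : ℝ) ^ ε := by
  have redundancy_le : ∀ᶠ n : ℕ in Filter.atTop, ‖(redundancy n : ℝ)‖ ≤ Real.logb 2 n + 3 := by
    filter_upwards [Filter.eventually_ge_atTop 1] with n hn
    have clog_lt : (Nat.clog 2 n : ℝ) < Real.logb 2 n + 1 := by
      rw [← Real.natCeil_logb_natCast]
      exact Nat.ceil_lt_add_one (Real.logb_nonneg one_lt_two (by exact_mod_cast hn))
    have := Nat.cast_le (α := ℝ).2 (redundancy_le_clog_add_two n)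
    rw [Real.norm_natCast]
    push_cast at this
    linarith
  have logb_isLittleO : (fun x : ℝ => Real.logb 2 x) =o[Filter.atTop] fun x : ℝ => x ^ ε := by
    simpa only [Real.logb, div_eq_inv_mul] using (isLittleO_log_rpow_atTop hε).const_mul_left _
  have const_isLittleO : (fun _ : ℝ => (3 : ℝ)) =o[Filter.atTop] fun x : ℝ => x ^ ε :=
    (Asymptotics.isLittleO_const_left_of_ne (by norm_num)).2
      (tendsto_norm_atTop_atTop.comp (tendsto_rpow_atTop hε))
  exact (Asymptotics.IsBigO.of_bound' (redundancy_le.mono fun n h => h.trans (le_abs_self _))).trans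
    ((logb_isLittleO.add const_isLittleO).isBigO.comp_tendsto tendsto_natCast_atTop_atTop)

theorem bSeq_isTheta_sq :
    (fun i : ℕ => (bSeq i : ℝ)) =Θ[Filter.atTop] fun i : ℕ => (i : ℝ) ^ 2 := by
  constructor
  · refine Asymptotics.IsBigO.of_bound' ?_
    filter_upwards [Filter.eventually_ge_atTop 2] with i hi
    have : bSeq i ≤ i ^ 2 := Nat.div_le_of_le_mul (by nlinarith)
    simpa using (by exact_mod_cast this : (bSeq i : ℝ) ≤ (i : ℝ) ^ 2)
  · refine Asymptotics.IsBigO.of_bound 4 (.of_forall fun i => ?_)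
    have : i ^ 2 ≤ 4 * bSeq i := by
      have : (i + 2) ^ 2 = i ^ 2 + 4 * i + 4 := by ring
      unfold bSeq
      omega
    simpa using (by exact_mod_cast this : (i : ℝ) ^ 2 ≤ 4 * bSeq i)

theorem summable_redundancy_bSeq_div_bSeq :
    Summable fun i => (redundancy (bSeq i) : ℝ) / bSeq i := by
  have tendsto_bSeq : Filter.Tendsto bSeq Filter.atTop Filter.atTop := by
    refine Filter.tendsto_atTop_mono (fun i => ?_) Filter.tendsto_id
    have : (i + 2) ^ 2 = i ^ 2 + 4 * i + 4 := by ring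
    unfold bSeq
    dsimp
    omega
  have redundancy_isBigO : (fun i => (redundancy (bSeq i) : ℝ)) =O[Filter.atTop]
      fun i : ℕ => ((i : ℝ) ^ 2) ^ (1 / 4 : ℝ) :=
    ((redundancy_isBigO_rpow (by norm_num)).comp_tendsto tendsto_bSeq).trans
      (bSeq_isTheta_sq.1.rpow (by norm_num) (.of_forall fun i => by positivity))
  refine summable_of_isBigO_nat (Real.summable_nat_rpow (p := -(3 / 2)) |>.2 (by norm_num))
    ((redundancy_isBigO.mul bSeq_isTheta_sq.inv.1).trans_eventuallyEq ?_)
  filter_upwards [Filter.eventually_gt_atTop 0] with i hi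
  have hi' : (0 : ℝ) < i := by exact_mod_cast hi
  rw [← Real.rpow_natCast, ← Real.rpow_mul hi'.le, ← Real.rpow_neg hi'.le, ← Real.rpow_add hi']
  norm_num

end RelayChain

theorem theorem4 :
    -- the total transmission time is `O(m + k)`
    (∃ C : ℝ, ∀ m k : ℕ, 1 ≤ m → 1 ≤ k →
      (RelayChain.transmissionTime RelayChain.bSeq RelayChain.tSeq m k : ℝ) ≤ C * (m + k)) ∧
    -- the error probability tends to `0` as `m → ∞`, whatever `k` and the message are
    (∀ p : unitInterval, (p : ℝ) < (3 : ℝ) ^ (-8 : ℤ) / 4 →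
      ∀ ε : ℝ, 0 < ε → ∃ m₀ : ℕ, ∀ (m k : ℕ) (hm : 0 < m), m₀ ≤ m → 1 ≤ k →
        ∀ msg : Fin k → ZMod 2,
          (RelayChain.multiBitProtocol RelayChain.bSeq RelayChain.tSeq m k).errorProb hm p msg
            ≤ ε) := by
  constructor
  · refine RelayChain.exists_transmissionTime_le RelayChain.two_le_bSeq (r := 5 / 9) (by norm_num)
      (by norm_num) (fun i hi => ?_) RelayChain.summable_redundancy_bSeq_div_bSeq
    have rate_le : (9 * (RelayChain.bSeq i + RelayChain.redundancy (RelayChain.bSeq i)) : ℝ) ≤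
        5 * RelayChain.tSeq i := by exact_mod_cast RelayChain.bSeq_add_redundancy_le i hi
    linarith
  · intro p hp ε hε
    obtain ⟨l, hl⟩ := exists_nat_one_div_lt hε
    refine ⟨RelayChain.hopLen RelayChain.tSeq l + 1, fun m k hm hlm _ msg => ?_⟩
    have le_topLevel : l ≤ RelayChain.topLevel RelayChain.bSeq RelayChain.tSeq m k :=
      RelayChain.le_topLevel_of_hopLen_lt _ RelayChain.two_le_tSeq hlm k
    calc (RelayChain.multiBitProtocol RelayChain.bSeq RelayChain.tSeq m k).errorProb hm p msg
        ≤ 1 / ((RelayChain.topLevel RelayChain.bSeq RelayChain.tSeq m k : ℝ) + 1) :=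
          RelayChain.errorProb_multiBitProtocol_le hm hp.le msg
      _ ≤ 1 / ((l : ℝ) + 1) := Nat.one_div_le_one_div le_topLevel
      _ ≤ ε := hl.le
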